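/- **Theorem (differential privacy of SGLD with a fixed step size).** *Algorithm.* Let $X=(d_1,\dots,d_N)\in\mathcal X^N$ be a dataset, $p(\theta)$ a prior and $\ell(\theta\mid d)$ a likelihood, $\theta\in\mathbb R^r$. Let $1\le\tau\le N$ be the minibatch size, $q=\tau/N$ the sampling probability, $T$ the number of iterations, $L>0$ the gradient norm bound and $\eta_1,\dots,\eta_T>0$ the step sizes. Start from a (possibly random) point $\theta_1$ whose law $\mu_0$ does not depend on the data. At iteration $t=1,\dots,T$, draw a random minibatch $J_t\subseteq\{1,\dots,N\}$ containing each index independently with probability $q$, draw $z_t\sim N(0,\tfrac{\eta_t}{N}I_r)$ (all draws being independent), put $$g_t(d_i)=\nabla_\theta\log\ell(\theta_t\mid d_i),\qquad \tilde g_t(d_i)=\frac{g_t(d_i)}{\max\left(1,\|g_t(d_i)\|_2/L\right)},$$ $$\theta_{t+1}=\theta_t-\eta_t\Big(\frac{\nabla\log p(\theta_t)}{N}+\frac1\tau\sum_{i\in J_t}\tilde g_t(d_i)\Big)+z_t ,$$ and return $\theta_{t+1}$. (Where a function is not differentiable its gradient is read as $0$.) The output of the algorithm is the whole sequence $(\theta_2,\dots,\theta_{T+1})$.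 *Privacy.* A randomized mechanism $\mathcal M$ on $\mathcal X^N$ is $(\epsilon,\delta)$-differentially private if $\Pr(\mathcal M(X)\in S)\le e^{\epsilon}\Pr(\mathcal M(X')\in S)+\delta$ for all measurable $S$ and all datasets $X,X'\in\mathcal X^N$ that differ in exactly one record. *Statement.* For every $K>0$ there exist constants $c_1,c>0$, depending only on $K$, such that the following holds for all $\mathcal X$, $p$, $\ell$, $r$, $\mu_0$, $L$, $N$, $\tau$, $T$ as above and all $\epsilon>0$, $0<\delta<1$ with $\epsilon\le K\log(1/\delta)$. If $\epsilon<c_1q^2T$, then the algorithm with the constant step size $\eta_t=\eta>0$ is $(\epsilon,\delta)$-differentially private whenever $$\eta<\frac{\epsilon^2N}{c^2L^2\,T\log(1/\delta)} .$$ -/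

import Mathlib

open MeasureTheory ProbabilityTheory

noncomputable section

/-- Two datasets of size `N` are adjacent if they differ in exactly one record. -/
def AdjacentDatasets {𝒳 : Type*} {N : ℕ} (X X' : Fin N → 𝒳) : Prop :=
  ∃ i, X i ≠ X' i ∧ ∀ j, j ≠ i → X j = X' j

/-- A randomized mechanism is a family of random variables `M X : Ω → 𝒴`, one for each dataset `X`,
on a probability space `(Ω, P)`. It is `(ε, δ)`-differentially private if
`Pr(M X ∈ S) ≤ e^ε Pr(M X' ∈ S) + δ` for all adjacent `X`, `X'` and all measurable `S`. -/
def DifferentiallyPrivate {𝒳 Ω 𝒴 : Type*} [MeasurableSpace Ω] [MeasurableSpace 𝒴] {N : ℕ}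
    (P : Measure Ω) (M : (Fin N → 𝒳) → Ω → 𝒴) (ε δ : ℝ) : Prop :=
  ∀ X X' : Fin N → 𝒳, AdjacentDatasets X X' → ∀ S : Set 𝒴, MeasurableSet S →
    P {ω | M X ω ∈ S} ≤ ENNReal.ofReal (Real.exp ε) * P {ω | M X' ω ∈ S} + ENNReal.ofReal δ

/-- The law of one coin with success probability `q ∈ [0, 1]`. -/
def coinLaw (q : ℝ) : Measure Bool :=
  ENNReal.ofReal q • Measure.dirac true + ENNReal.ofReal (1 - q) • Measure.dirac false

/-- The law of a random minibatch with sampling probability `q`: each of the `N` records is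
included independently with probability `q` (record `i` is in the minibatch `J` iff `J i = true`). -/
def minibatchLaw (N : ℕ) (q : ℝ) : Measure (Fin N → Bool) :=
  Measure.pi fun _ => coinLaw q

/-- The law of a noise vector whose coordinates are i.i.d. `N(0, v)`. -/
def noiseLaw (r : ℕ) (v : ℝ) : Measure (Fin r → ℝ) :=
  Measure.pi fun _ => gaussianReal 0 v.toNNReal

/-- Norm clipping at level `L`: `g / max(1, ‖g‖₂ / L)`. -/
def clip {r : ℕ} (L : ℝ) (g : EuclideanSpace ℝ (Fin r)) : EuclideanSpace ℝ (Fin r) :=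
  (max 1 (‖g‖ / L))⁻¹ • g

/-- The randomness of a run of `T` iterations: the initial point, and for each iteration the
minibatch and the noise vector. -/
abbrev SGLDSample (N r T : ℕ) : Type :=
  EuclideanSpace ℝ (Fin r) × (Fin T → (Fin N → Bool) × (Fin r → ℝ))

/-- The law of that randomness. The initial point has law `μ₀`, the minibatches have sampling
probability `τ / N`, the noise at iteration `t` has variance `η t / N` in each coordinate, and all
of these are independent. -/
def sgldLaw {N r T : ℕ} (μ₀ : Measure (EuclideanSpace ℝ (Fin r))) (τ : ℕ) (η : Fin T → ℝ) :
    Measure (SGLDSample N r T) :=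
  μ₀.prod (Measure.pi fun t =>
    (minibatchLaw N ((τ : ℝ) / (N : ℝ))).prod (noiseLaw r (η t / (N : ℝ))))

/-- One iteration with step size `η`, minibatch `J` and noise `z`, for the prior density `p` and the
likelihood `lik d θ = ℓ(θ | d)`:
`θ ↦ θ - η (∇ log p(θ) / N + (1 / τ) ∑_{i ∈ J} clip_L (∇ log ℓ(θ | dᵢ))) + z`. -/
def sgldStep {𝒳 : Type*} {N r : ℕ} (p : EuclideanSpace ℝ (Fin r) → ℝ)
    (lik : 𝒳 → EuclideanSpace ℝ (Fin r) → ℝ) (L : ℝ) (τ : ℕ) (X : Fin N → 𝒳) (η : ℝ)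
    (θ : EuclideanSpace ℝ (Fin r)) (J : Fin N → Bool) (z : Fin r → ℝ) :
    EuclideanSpace ℝ (Fin r) :=
  θ - η • ((N : ℝ)⁻¹ • gradient (fun ϑ => Real.log (p ϑ)) θ
      + (τ : ℝ)⁻¹ • ∑ i with J i = true, clip L (gradient (fun ϑ => Real.log (lik (X i) ϑ)) θ))
    + WithLp.toLp 2 z

/-- The iterates `θ₁, …, θ_{T+1}`, indexed by `Fin (T + 1)` starting from `0`. -/
def sgldIterate {𝒳 : Type*} {N r T : ℕ} (p : EuclideanSpace ℝ (Fin r) → ℝ)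
    (lik : 𝒳 → EuclideanSpace ℝ (Fin r) → ℝ) (L : ℝ) (τ : ℕ) (η : Fin T → ℝ)
    (X : Fin N → 𝒳) (ω : SGLDSample N r T) : Fin (T + 1) → EuclideanSpace ℝ (Fin r) :=
  Fin.induction ω.1 fun t θ => sgldStep p lik L τ X (η t) θ (ω.2 t).1 (ω.2 t).2

/-- Differentially private stochastic gradient Langevin dynamics, as a mechanism. Its output is the
whole sequence of returned samples `θ₂, …, θ_{T+1}`. -/
def sgld {𝒳 : Type*} {N r T : ℕ} (p : EuclideanSpace ℝ (Fin r) → ℝ)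
    (lik : 𝒳 → EuclideanSpace ℝ (Fin r) → ℝ) (L : ℝ) (τ : ℕ) (η : Fin T → ℝ)
    (X : Fin N → 𝒳) (ω : SGLDSample N r T) : Fin T → EuclideanSpace ℝ (Fin r) :=
  fun t => sgldIterate p lik L τ η X ω t.succ

end

/-!
The proof runs the Rényi-divergence ("moments") accountant in a dual form that never mentions
densities of the output. Two random outputs `f`, `f'` on the same probability space are compared by
`HolderDominated`: `E g(f) ≤ B · (E g(f')^s)^{1/s}` for every measurable `g ≥ 0`. By Hölder duality
this is a bound on a Rényi divergence, and it survives everything the algorithm does: averaging over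
shared randomness (Jensen, `HolderDominated.prod`) and adaptive composition over the iterations,
where the constants multiply (`HolderDominated.pi_trajectory`).

So only one iteration from a fixed point has to be analysed. Conditionally on the minibatch
membership of the common records, the two updates have, up to a common translation, the laws
`(1 - q) N(0, v I) + q N(a, v I)` and `(1 - q) N(0, v I) + q N(b, v I)`, with `v = η / N` and
`‖a‖, ‖b‖ ≤ η L / τ`. Both are compared with `N(0, v I)`. With `ξ` the log density ratio of
`N(a, v I)` to `N(0, v I)`, so that `E e^{cξ} = e^{c (c - 1) σ}` where `σ = ‖a‖² / (2 v)`, Hölder's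
inequality reduces this to bounds `E (1 - q + q e^ξ)^k ≤ e^{C k² q² σ}` for `k = m` and for
`k = -(m - 1)`:

* for the positive power, which needs `m σ ≤ 1`, the binomial expansion gives a sum estimated in
  `sum_binomial_exp_le`;
* for the negative power, weighted AM-GM suffices when `n q ≥ 1`, `n = m - 1`; otherwise a
  second-order expansion (`inv_pow_le_taylor`) does, whose first-order term has mean zero.

Each iteration therefore costs a factor `e^{63 m L² η / N}`, the sampling probability having
cancelled: `q² σ ≤ L² η / (2 N)`. Choosing `m` of order `log (1 / δ) / ε`, the bound on `η` keeps
the product over the `T` iterations below `e^{ε / 2}`, and `ε < q² T` supplies `m σ ≤ 1`. The resulting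
inequality `P(S) ≤ e^{ε / 2} P'(S)^{1 - 2 / m}` implies `P(S) ≤ e^ε P'(S) + δ`
(`mul_rpow_le_exp_mul_add`). The hypothesis `ε ≤ K log (1 / δ)` bounds the effect of rounding `m` up
to an integer.
-/

/-! ### Elementary inequalities -/

/-- The second factorial moment of the binomial weights, for arbitrary `a` and `b`. -/
theorem sum_choose_mul_descFactorial_two (a b : ℝ) (n : ℕ) :
    ∑ k ∈ Finset.range (n + 2 + 1), b ^ k * a ^ (n + 2 - k) * ((n + 2).choose k : ℝ) * (k * (k - 1))
      = (n + 2) * (n + 1) * b ^ 2 * (b + a) ^ n := by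
  rw [Finset.sum_range_succ', Finset.sum_range_succ', add_pow, Finset.mul_sum]
  simp only [zero_add, Nat.cast_one, sub_self, mul_zero, Nat.cast_zero, zero_mul, add_zero]
  refine Finset.sum_congr rfl fun k _ => ?_
  have h1 : ((n : ℝ) + 1) * (n.choose k) = ((n + 1).choose (k + 1)) * (k + 1) := by
    exact_mod_cast Nat.add_one_mul_choose_eq n k
  have h2 : ((n : ℝ) + 1 + 1) * ((n + 1).choose (k + 1))
      = ((n + 2).choose (k + 1 + 1)) * (k + 1 + 1) := by
    exact_mod_cast Nat.add_one_mul_choose_eq (n + 1) (k + 1)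
  rw [show n + 2 - (k + 1 + 1) = n - k by omega]
  push_cast
  linear_combination (-(a ^ (n - k) * b ^ (k + 2)) * (k + 1)) * h2
    - (a ^ (n - k) * b ^ (k + 2) * (n + 2)) * h1

/-- The moment `E e^{k (k - 1) σ}` for `k` binomial with parameters `m` and `q`. The constraint
`m σ ≤ 1` makes the exponent at most linear in `k`, hence controlled by the binomial tail; the bound
is quadratic in `m q` because `k (k - 1)` has mean `m (m - 1) q²`. -/
theorem sum_binomial_exp_le {q σ : ℝ} {m : ℕ} (hq0 : 0 ≤ q) (hq1 : q ≤ 1) (hσ : 0 ≤ σ)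
    (hm : m * σ ≤ 1) :
    ∑ k ∈ Finset.range (m + 1), q ^ k * (1 - q) ^ (m - k) * (m.choose k : ℝ)
        * Real.exp (k * (k - 1) * σ)
      ≤ Real.exp (114 * (m ^ 2 * q ^ 2 * σ)) := by
  obtain hm2 | ⟨n, rfl⟩ : m < 2 ∨ ∃ n, m = n + 2 := by
    rcases lt_or_ge m 2 with h | h
    · exact Or.inl h
    · exact Or.inr ⟨m - 2, by omega⟩
  · have h1 : (1 : ℝ) ≤ Real.exp (114 * (m ^ 2 * q ^ 2 * σ)) := Real.one_le_exp (by positivity)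
    interval_cases m
    · simp
    · simp [Finset.sum_range_succ] at h1 ⊢
      linarith
  set t : ℝ := Real.exp 2 with ht
  have ht8 : t ≤ 8 := by
    have h := Real.exp_one_lt_d9
    have : t = Real.exp 1 * Real.exp 1 := by rw [ht, ← Real.exp_add]; norm_num
    rw [this]; nlinarith [Real.exp_pos 1]
  have ht1 : 1 ≤ t := Real.one_le_exp (by norm_num)
  set y : ℝ := (n + 2 : ℕ) * q with hy
  have hy0 : 0 ≤ y := by positivity
  set w : ℝ := y ^ 2 * σ with hw
  have hw0 : 0 ≤ w := by positivity
  set A : ℝ := t - 1 with hA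
  have hA0 : 0 ≤ A := by simp only [hA]; linarith
  set c : ℕ → ℝ := fun k => q ^ k * (1 - q) ^ (n + 2 - k) * ((n + 2).choose k : ℝ) with hc
  have hc0 : ∀ k, 0 ≤ c k := fun k => by
    have : 0 ≤ 1 - q := by linarith
    positivity
  have hkk : ∀ k : ℕ, (0 : ℝ) ≤ k * (k - 1) := fun k => by
    rcases Nat.eq_zero_or_pos k with rfl | hk
    · simp
    · have : (1 : ℝ) ≤ k := by exact_mod_cast hk
      exact mul_nonneg (by linarith) (by linarith)
  have hpt : ∀ k ∈ Finset.range (n + 2 + 1), c k * Real.exp (k * (k - 1) * σ) ≤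
      c k + σ * Real.exp (A ^ 2 * w) * (c k * (k * (k - 1)))
        + σ * Real.exp (-(A * y)) * (c k * t ^ k * (k * (k - 1))) := by
    intro k hk
    have hkm : (k : ℝ) ≤ (n + 2 : ℕ) := by
      exact_mod_cast Nat.lt_succ_iff.mp (Finset.mem_range.mp hk)
    have hk0 : (0 : ℝ) ≤ k := k.cast_nonneg
    have hx0 : 0 ≤ k * (k - 1) * σ := mul_nonneg (hkk k) hσ
    have h1 : Real.exp (k * (k - 1) * σ) ≤ 1 + k * (k - 1) * σ * Real.exp (k * (k - 1) * σ) := by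
      have := Real.add_one_le_exp (-(k * (k - 1) * σ))
      have h3 : Real.exp (-(k * (k - 1) * σ)) * Real.exp (k * (k - 1) * σ) = 1 := by
        rw [← Real.exp_add]; simp
      nlinarith [Real.exp_pos (k * (k - 1) * σ)]
    -- Below `A y` the exponent is at most `A² w`. Above it, `k (k - 1) σ ≤ k ≤ 2 k - A y`, and
    -- `A = t - 1` makes `e^{-A y}` absorb the generating function `(1 + A q)^m ≤ e^{A y}` of `t^k`.
    have h2 : Real.exp (k * (k - 1) * σ) ≤
        Real.exp (A ^ 2 * w) + Real.exp (-(A * y)) * t ^ k := by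
      rcases le_or_gt (k : ℝ) (A * y) with h | h
      · have : Real.exp (k * (k - 1) * σ) ≤ Real.exp (A ^ 2 * w) := by
          apply Real.exp_le_exp.mpr
          have : (k : ℝ) * (k - 1) ≤ (A * y) ^ 2 := by nlinarith
          calc _ ≤ (A * y) ^ 2 * σ := mul_le_mul_of_nonneg_right this hσ
            _ = _ := by rw [hw]; ring
        have : 0 ≤ Real.exp (-(A * y)) * t ^ k := by positivity
        linarith
      · have : Real.exp (k * (k - 1) * σ) ≤ Real.exp (-(A * y)) * t ^ k := by
          rw [ht, ← Real.exp_nat_mul, ← Real.exp_add]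
          apply Real.exp_le_exp.mpr
          have h5 : (k : ℝ) * σ ≤ 1 := le_trans (mul_le_mul_of_nonneg_right hkm hσ) hm
          have : (k : ℝ) * (k - 1) * σ ≤ k := by nlinarith
          linarith
        have := Real.exp_pos (A ^ 2 * w)
        linarith
    have h3 : Real.exp (k * (k - 1) * σ) ≤
        1 + k * (k - 1) * σ * (Real.exp (A ^ 2 * w) + Real.exp (-(A * y)) * t ^ k) :=
      h1.trans (by gcongr)
    calc _ ≤ c k * (1 + k * (k - 1) * σ * (Real.exp (A ^ 2 * w) + Real.exp (-(A * y)) * t ^ k)) :=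
          mul_le_mul_of_nonneg_left h3 (hc0 k)
      _ = _ := by ring
  have hs0 : ∑ k ∈ Finset.range (n + 2 + 1), c k = 1 := by
    rw [← add_pow]; simp
  have hs1 := sum_choose_mul_descFactorial_two (1 - q) q n
  have hs2 := sum_choose_mul_descFactorial_two (1 - q) (t * q) n
  have hs2' : ∑ k ∈ Finset.range (n + 2 + 1), c k * t ^ k * (k * (k - 1))
      = (n + 2) * (n + 1) * (t * q) ^ 2 * (t * q + (1 - q)) ^ n := by
    rw [← hs2]; refine Finset.sum_congr rfl fun k _ => ?_
    simp only [hc, mul_pow]; ring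
  have hnn : ((n : ℝ) + 2) * (n + 1) * q ^ 2 ≤ y ^ 2 := by
    rw [hy]; push_cast
    have : (0 : ℝ) ≤ n := n.cast_nonneg
    nlinarith [sq_nonneg q, mul_nonneg this (sq_nonneg q)]
  have hpow : (t * q + (1 - q)) ^ n ≤ Real.exp (A * y) := by
    have : t * q + (1 - q) ≤ Real.exp (A * q) := by
      have := Real.add_one_le_exp (A * q)
      simp only [hA] at this ⊢; linarith
    calc _ ≤ Real.exp (A * q) ^ n := pow_le_pow_left₀ (by nlinarith) this n
      _ = Real.exp (n * (A * q)) := by rw [← Real.exp_nat_mul]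
      _ ≤ _ := by
        apply Real.exp_le_exp.mpr
        rw [hy]; push_cast
        nlinarith [mul_nonneg hA0 hq0]
  have hB : Real.exp (-(A * y)) * ∑ k ∈ Finset.range (n + 2 + 1), c k * t ^ k * (k * (k - 1))
      ≤ t ^ 2 * y ^ 2 := by
    rw [hs2']
    have hbb : 0 ≤ t * q + (1 - q) := by nlinarith
    have h6 : ((n : ℝ) + 2) * (n + 1) * (t * q) ^ 2 * (t * q + (1 - q)) ^ n
        ≤ (t ^ 2 * y ^ 2) * Real.exp (A * y) := by
      apply mul_le_mul _ hpow (by positivity) (by positivity)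
      calc _ = t ^ 2 * (((n : ℝ) + 2) * (n + 1) * q ^ 2) := by ring
        _ ≤ _ := by gcongr
    calc _ ≤ Real.exp (-(A * y)) * ((t ^ 2 * y ^ 2) * Real.exp (A * y)) := by gcongr
      _ = (t ^ 2 * y ^ 2) * (Real.exp (-(A * y)) * Real.exp (A * y)) := by ring
      _ = _ := by rw [← Real.exp_add]; simp
  have hA1 : ∑ k ∈ Finset.range (n + 2 + 1), c k * (k * (k - 1)) ≤ y ^ 2 := by
    simp only [hc]; rw [hs1]; simpa using hnn
  have hexpA : 1 ≤ Real.exp (A ^ 2 * w) := Real.one_le_exp (by positivity)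
  calc _ ≤ ∑ k ∈ Finset.range (n + 2 + 1), (c k + σ * Real.exp (A ^ 2 * w) * (c k * (k * (k - 1)))
        + σ * Real.exp (-(A * y)) * (c k * t ^ k * (k * (k - 1)))) := Finset.sum_le_sum hpt
    _ = 1 + σ * Real.exp (A ^ 2 * w) * ∑ k ∈ Finset.range (n + 2 + 1), c k * (k * (k - 1))
        + σ * (Real.exp (-(A * y)) *
          ∑ k ∈ Finset.range (n + 2 + 1), c k * t ^ k * (k * (k - 1))) := by
      rw [Finset.sum_add_distrib, Finset.sum_add_distrib, hs0, Finset.mul_sum, ← mul_assoc σ,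
        Finset.mul_sum]
    _ ≤ 1 + σ * Real.exp (A ^ 2 * w) * y ^ 2 + σ * (t ^ 2 * y ^ 2) := by gcongr
    _ = 1 + w * Real.exp (A ^ 2 * w) + t ^ 2 * w := by rw [hw]; ring
    _ ≤ Real.exp (A ^ 2 * w) * ((1 + t ^ 2) * w + 1) := by
      nlinarith [mul_nonneg (sq_nonneg t) hw0]
    _ ≤ Real.exp (A ^ 2 * w) * Real.exp ((1 + t ^ 2) * w) := by
      gcongr; exact Real.add_one_le_exp _
    _ = Real.exp ((A ^ 2 + (1 + t ^ 2)) * w) := by rw [← Real.exp_add]; ring_nf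
    _ ≤ _ := by
      apply Real.exp_le_exp.mpr
      have : A ^ 2 + (1 + t ^ 2) ≤ 114 := by simp only [hA]; nlinarith
      calc _ ≤ 114 * w := by gcongr
        _ = _ := by rw [hw, hy]; ring

/-- A second-order upper bound for `(1 + x)^{-n}` whose remainder is weighted by the function
itself, so that it stays usable near `x = -1`. -/
theorem inv_pow_le_taylor {x : ℝ} (hx : -1 < x) (n : ℕ) :
    ((1 + x)⁻¹) ^ n ≤ 1 - n * x + n ^ 2 * (x ^ 2 * (1 + ((1 + x)⁻¹) ^ n)) := by
  set y := (1 + x)⁻¹ with hy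
  have hy0 : 0 < y := inv_pos.mpr (by linarith)
  have hxy : 1 - y = x * y := by
    have : (1 + x) * y = 1 := mul_inv_cancel₀ (by linarith)
    linarith
  have hM : ∀ j ≤ n, y ^ j ≤ 1 + y ^ n := fun j hj => by
    rcases le_total y 1 with h | h
    · have := pow_le_one₀ hy0.le h (n := j)
      have := pow_pos hy0 n
      linarith
    · have := pow_le_pow_right₀ h hj
      linarith
  generalize 1 + y ^ n = M at hM ⊢
  have key : ∀ k ≤ n, y ^ k ≤ 1 - k * x + k ^ 2 * (x ^ 2 * M) := by
    intro k
    induction k with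
    | zero => simp
    | succ k ih =>
      intro hk
      have h1 := ih (by omega)
      have hgeo : 1 - y ^ (k + 1) = x * ∑ j ∈ Finset.range (k + 1), y ^ (j + 1) := by
        have h2 := geom_sum_mul y (k + 1)
        have h3 : ∑ j ∈ Finset.range (k + 1), y ^ (j + 1)
            = y * ∑ j ∈ Finset.range (k + 1), y ^ j := by
          rw [Finset.mul_sum]; exact Finset.sum_congr rfl fun j _ => by ring
        rw [h3]; linear_combination h2 + (∑ j ∈ Finset.range (k + 1), y ^ j) * hxy
      have hs : ∑ j ∈ Finset.range (k + 1), y ^ (j + 1) ≤ (k + 1) * M := by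
        calc _ ≤ ∑ j ∈ Finset.range (k + 1), M :=
              Finset.sum_le_sum fun j hj => hM _ (by have := Finset.mem_range.mp hj; omega)
          _ = _ := by simp
      have hyk : y ^ (k + 1) = y ^ k - x * (1 - x * ∑ j ∈ Finset.range (k + 1), y ^ (j + 1)) := by
        rw [← hgeo]; rw [pow_succ]; linear_combination -y ^ k * hxy
      have hx2 := mul_le_mul_of_nonneg_left hs (sq_nonneg x)
      have hM0 : 0 ≤ M := (hM 0 (by omega)).trans' (by simp)
      have hk0 : (0 : ℝ) ≤ k * (x ^ 2 * M) := by positivity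
      rw [hyk]; push_cast
      nlinarith
  exact key n le_rfl

/-! ### Moments of a Gaussian mixture density -/

/-- `ξ` has under `μ` the moment generating function of the log density ratio of two Gaussians with
equal covariance, the one in the denominator being `μ`; `σ` is half the squared Mahalanobis distance
between their means. -/
structure IsGaussianLogRatio {Ω : Type*} [MeasurableSpace Ω] (μ : Measure Ω) (ξ : Ω → ℝ) (σ : ℝ) :
    Prop where
  measurable : Measurable ξ
  nonneg : 0 ≤ σ
  integrable : ∀ c : ℝ, Integrable (fun x => Real.exp (c * ξ x)) μ
  integral_eq : ∀ c : ℝ, ∫ x, Real.exp (c * ξ x) ∂μ = Real.exp (c * (c - 1) * σ)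

/-- The density with respect to `μ` of the mixture `(1 - q) μ + q e^ξ μ`. -/
noncomputable def mixtureDensity {Ω : Type*} (q : ℝ) (ξ : Ω → ℝ) (x : Ω) : ℝ :=
  1 - q + q * Real.exp (ξ x)

/-- Weighted AM-GM. -/
theorem exp_mul_le_mixtureDensity {Ω : Type*} {q : ℝ} (hq0 : 0 ≤ q) (hq1 : q ≤ 1) (ξ : Ω → ℝ)
    (x : Ω) : Real.exp (q * ξ x) ≤ mixtureDensity q ξ x := by
  have h := convexOn_exp.2 (Set.mem_univ 0) (Set.mem_univ (ξ x)) (sub_nonneg.2 hq1) hq0 (by ring)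
  simpa [mixtureDensity] using h

theorem mixtureDensity_pos {Ω : Type*} {q : ℝ} (hq0 : 0 ≤ q) (hq1 : q ≤ 1) (ξ : Ω → ℝ) (x : Ω) :
    0 < mixtureDensity q ξ x :=
  (Real.exp_pos _).trans_le (exp_mul_le_mixtureDensity hq0 hq1 ξ x)

namespace IsGaussianLogRatio

variable {Ω : Type*} [MeasurableSpace Ω] {μ : Measure Ω} {ξ : Ω → ℝ} {σ q : ℝ}

theorem measurable_mixtureDensity (h : IsGaussianLogRatio μ ξ σ) :
    Measurable (mixtureDensity q ξ) := by
  have := h.measurable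
  unfold mixtureDensity
  fun_prop

theorem isProbabilityMeasure (h : IsGaussianLogRatio μ ξ σ) : IsProbabilityMeasure μ := by
  have h1 := h.integrable 0
  have h2 := h.integral_eq 0
  simp only [zero_mul, Real.exp_zero] at h1 h2
  have : IsFiniteMeasure μ := by
    simpa [integrable_const_iff] using h1
  refine ⟨?_⟩
  rw [integral_const, smul_eq_mul, mul_one, Measure.real] at h2
  rw [← ENNReal.ofReal_toReal (measure_ne_top μ Set.univ), h2, ENNReal.ofReal_one]

theorem lintegral_mixtureDensity_pow_le (h : IsGaussianLogRatio μ ξ σ) (hq0 : 0 ≤ q) (hq1 : q ≤ 1)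
    {m : ℕ} (hm : m * σ ≤ 1) :
    ∫⁻ x, ENNReal.ofReal (mixtureDensity q ξ x ^ m) ∂μ
      ≤ ENNReal.ofReal (Real.exp (114 * (m ^ 2 * q ^ 2 * σ))) := by
  have hexp : ∀ x, mixtureDensity q ξ x ^ m = ∑ k ∈ Finset.range (m + 1),
      q ^ k * (1 - q) ^ (m - k) * (m.choose k : ℝ) * Real.exp (k * ξ x) := by
    intro x
    rw [mixtureDensity, add_comm (1 - q), add_pow]
    refine Finset.sum_congr rfl fun k _ => ?_
    rw [mul_pow, ← Real.exp_nat_mul]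
    ring
  have hint : ∀ k ∈ Finset.range (m + 1), Integrable (fun x =>
      q ^ k * (1 - q) ^ (m - k) * (m.choose k : ℝ) * Real.exp (k * ξ x)) μ :=
    fun k _ => (h.integrable k).const_mul _
  rw [← ofReal_integral_eq_lintegral_ofReal]
  · apply ENNReal.ofReal_le_ofReal
    simp only [hexp]
    rw [integral_finsetSum _ hint]
    simp only [integral_const_mul, h.integral_eq]
    exact sum_binomial_exp_le hq0 hq1 h.nonneg hm
  · simp only [hexp]
    exact integrable_finsetSum _ hint
  · exact Filter.Eventually.of_forall fun x => pow_nonneg (mixtureDensity_pos hq0 hq1 ξ x).le m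

/-- The estimate has order `q²`. When `n q ≥ 1`, AM-GM alone gives `γ (γ + 1) σ ≤ 2 γ² σ` with
`γ = n q`; when `n q < 1` this would be of order `q`, and the second-order bound is used. -/
theorem lintegral_mixtureDensity_inv_pow_le (h : IsGaussianLogRatio μ ξ σ) (hq0 : 0 ≤ q)
    (hq1 : q ≤ 1) (hσ : 2 * σ ≤ 1) (n : ℕ) :
    ∫⁻ x, ENNReal.ofReal ((mixtureDensity q ξ x)⁻¹ ^ n) ∂μ
      ≤ ENNReal.ofReal (Real.exp (12 * (n ^ 2 * q ^ 2 * σ))) := by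
  have hσ0 := h.nonneg
  set γ : ℝ := n * q with hγ
  have hγ0 : 0 ≤ γ := by positivity
  have hamgm : ∀ x, (mixtureDensity q ξ x)⁻¹ ^ n ≤ Real.exp (-γ * ξ x) := by
    intro x
    have h1 := exp_mul_le_mixtureDensity hq0 hq1 ξ x
    have h2 : (mixtureDensity q ξ x)⁻¹ ≤ Real.exp (-(q * ξ x)) := by
      rw [Real.exp_neg]
      exact inv_anti₀ (Real.exp_pos _) h1
    calc _ ≤ Real.exp (-(q * ξ x)) ^ n :=
          pow_le_pow_left₀ (inv_nonneg.2 (mixtureDensity_pos hq0 hq1 ξ x).le) h2 n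
      _ = _ := by rw [← Real.exp_nat_mul, hγ]; ring_nf
  have hle : ∀ f : Ω → ℝ, Integrable f μ → (∀ x, (mixtureDensity q ξ x)⁻¹ ^ n ≤ f x) →
      ∫⁻ x, ENNReal.ofReal ((mixtureDensity q ξ x)⁻¹ ^ n) ∂μ ≤ ENNReal.ofReal (∫ x, f x ∂μ) := by
    intro f hf hfx
    rw [ofReal_integral_eq_lintegral_ofReal hf (Filter.Eventually.of_forall fun x =>
      (pow_nonneg (inv_nonneg.2 (mixtureDensity_pos hq0 hq1 ξ x).le) n).trans (hfx x))]
    exact lintegral_mono fun x => ENNReal.ofReal_le_ofReal (hfx x)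
  rcases le_or_gt 1 γ with hγ1 | hγ1
  · refine (hle _ (h.integrable _) hamgm).trans (ENNReal.ofReal_le_ofReal ?_)
    rw [h.integral_eq]
    apply Real.exp_le_exp.2
    have : γ ^ 2 * σ = n ^ 2 * q ^ 2 * σ := by rw [hγ]; ring
    rw [← this]
    nlinarith [mul_nonneg (mul_nonneg hγ0 (sub_nonneg.2 hγ1)) hσ0, mul_nonneg (sq_nonneg γ) hσ0]
  · have hprob := h.isProbabilityMeasure
    -- `f` is `1 - γ w + γ² w² (1 + e^{-γ ξ})` with `w = e^ξ - 1`, expanded into exponentials.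
    set f : Ω → ℝ := fun x => (1 + γ) + -γ * Real.exp (1 * ξ x) + γ ^ 2 *
      ((Real.exp (2 * ξ x) + -2 * Real.exp (1 * ξ x) + 1) +
        (Real.exp ((2 - γ) * ξ x) + -2 * Real.exp ((1 - γ) * ξ x) + Real.exp (-γ * ξ x))) with hf
    have i := h.integrable
    have i1 : Integrable (fun x => (1 + γ) + -γ * Real.exp (1 * ξ x)) μ :=
      (integrable_const _).add ((i 1).const_mul _)
    have i2 : Integrable (fun x => Real.exp (2 * ξ x) + -2 * Real.exp (1 * ξ x)) μ :=
      (i 2).add ((i 1).const_mul _)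
    have i3 : Integrable (fun x => Real.exp (2 * ξ x) + -2 * Real.exp (1 * ξ x) + 1) μ :=
      i2.add (integrable_const _)
    have i4 : Integrable (fun x => Real.exp ((2 - γ) * ξ x) + -2 * Real.exp ((1 - γ) * ξ x)) μ :=
      (i _).add ((i _).const_mul _)
    have i5 : Integrable (fun x => Real.exp ((2 - γ) * ξ x) + -2 * Real.exp ((1 - γ) * ξ x)
        + Real.exp (-γ * ξ x)) μ := i4.add (i _)
    have i6 : Integrable (fun x => (Real.exp (2 * ξ x) + -2 * Real.exp (1 * ξ x) + 1) +
        (Real.exp ((2 - γ) * ξ x) + -2 * Real.exp ((1 - γ) * ξ x) + Real.exp (-γ * ξ x))) μ :=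
      i3.add i5
    have i7 : Integrable f μ := i1.add (i6.const_mul _)
    have hfx : ∀ x, (mixtureDensity q ξ x)⁻¹ ^ n ≤ f x := by
      intro x
      have hpos := mixtureDensity_pos hq0 hq1 ξ x
      have hx : mixtureDensity q ξ x = 1 + q * (Real.exp (ξ x) - 1) := by
        rw [mixtureDensity]; ring
      have ht := inv_pow_le_taylor (x := q * (Real.exp (ξ x) - 1)) (by linarith) n
      rw [← hx] at ht
      have h1 := hamgm x
      have e2 : Real.exp (2 * ξ x) = Real.exp (ξ x) ^ 2 := by rw [← Real.exp_nat_mul]; norm_num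
      have e3 : Real.exp ((2 - γ) * ξ x) = Real.exp (ξ x) ^ 2 * Real.exp (-γ * ξ x) := by
        rw [← e2, ← Real.exp_add]; ring_nf
      have e4 : Real.exp ((1 - γ) * ξ x) = Real.exp (ξ x) * Real.exp (-γ * ξ x) := by
        rw [← Real.exp_add]; ring_nf
      calc _ ≤ _ := ht
        _ ≤ 1 - n * (q * (Real.exp (ξ x) - 1)) + n ^ 2 * ((q * (Real.exp (ξ x) - 1)) ^ 2 *
            (1 + Real.exp (-γ * ξ x))) := by gcongr
        _ = f x := by
          simp only [hf]
          rw [e2, e3, e4, one_mul, hγ]; ring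
    have hval : ∫ x, f x ∂μ = 1 + γ ^ 2 * ((Real.exp (2 * σ) - 1) +
        (Real.exp ((2 - γ) * (1 - γ) * σ) + -2 * Real.exp ((1 - γ) * -γ * σ)
          + Real.exp (-γ * (-γ - 1) * σ))) := by
      simp only [hf]
      rw [integral_add i1 (i6.const_mul _), integral_const_mul,
        integral_add (integrable_const _) ((i 1).const_mul _), integral_const_mul, h.integral_eq]
      have : ∫ x, (Real.exp (2 * ξ x) + -2 * Real.exp (1 * ξ x) + 1) +
        (Real.exp ((2 - γ) * ξ x) + -2 * Real.exp ((1 - γ) * ξ x) + Real.exp (-γ * ξ x)) ∂μ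
        = _ := integral_add i3 i5
      rw [this, integral_add i2 (integrable_const _), integral_add (i 2) ((i 1).const_mul _),
        integral_add i4 (i _), integral_add (i _) ((i _).const_mul _), integral_const_mul,
        integral_const_mul]
      have e : Real.exp (1 * (1 - 1) * σ) = 1 := by simp
      simp only [h.integral_eq, integral_const, probReal_univ, one_smul, e]
      ring_nf
    refine (hle f i7 hfx).trans (ENNReal.ofReal_le_ofReal ?_)
    rw [hval]
    have hE : Real.exp (2 * σ) - 1 ≤ 4 * σ := by
      have h1 : |2 * σ| ≤ 1 := by rwa [abs_of_nonneg (by linarith)]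
      have h2 := (abs_le.1 (Real.abs_exp_sub_one_sub_id_le h1)).2
      nlinarith
    have e3 : Real.exp ((2 - γ) * (1 - γ) * σ)
        = Real.exp ((1 - γ) * -γ * σ) * Real.exp ((2 - 2 * γ) * σ) := by
      rw [← Real.exp_add]; ring_nf
    have e4 : Real.exp (-γ * (-γ - 1) * σ)
        = Real.exp ((1 - γ) * -γ * σ) * Real.exp (2 * γ * σ) := by
      rw [← Real.exp_add]; ring_nf
    have h1 : Real.exp ((1 - γ) * -γ * σ) ≤ 1 := by
      apply Real.exp_le_one_iff.2
      nlinarith [mul_nonneg (mul_nonneg (sub_nonneg.2 hγ1.le) hγ0) hσ0]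
    have h2 : Real.exp ((2 - 2 * γ) * σ) ≤ Real.exp (2 * σ) :=
      Real.exp_le_exp.2 (by nlinarith [mul_nonneg hγ0 hσ0])
    have h3 : Real.exp (2 * γ * σ) ≤ Real.exp (2 * σ) :=
      Real.exp_le_exp.2 (by nlinarith [mul_nonneg (sub_nonneg.2 hγ1.le) hσ0])
    have h4 : 1 ≤ Real.exp (2 * σ) := Real.one_le_exp (by linarith)
    have h5 := Real.exp_pos ((1 - γ) * -γ * σ)
    have h6 : Real.exp ((2 - γ) * (1 - γ) * σ) + -2 * Real.exp ((1 - γ) * -γ * σ)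
          + Real.exp (-γ * (-γ - 1) * σ) ≤ 2 * (Real.exp (2 * σ) - 1) := by
      rw [e3, e4]
      calc _ = Real.exp ((1 - γ) * -γ * σ) *
            (Real.exp ((2 - 2 * γ) * σ) + Real.exp (2 * γ * σ) - 2) := by ring
        _ ≤ Real.exp ((1 - γ) * -γ * σ) * (2 * (Real.exp (2 * σ) - 1)) := by
            gcongr; linarith
        _ ≤ 1 * (2 * (Real.exp (2 * σ) - 1)) := by gcongr
        _ = _ := one_mul _
    have h7 : (Real.exp (2 * σ) - 1) + (Real.exp ((2 - γ) * (1 - γ) * σ)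
        + -2 * Real.exp ((1 - γ) * -γ * σ) + Real.exp (-γ * (-γ - 1) * σ)) ≤ 12 * σ := by linarith
    calc _ ≤ 1 + γ ^ 2 * (12 * σ) := by gcongr
      _ = 12 * (n ^ 2 * q ^ 2 * σ) + 1 := by rw [hγ]; ring
      _ ≤ _ := Real.add_one_le_exp _

end IsGaussianLogRatio

/-! ### Translates of the noise law -/

theorem gaussianReal_eq_withDensity_exp (a : ℝ) {v : NNReal} (hv : v ≠ 0) :
    gaussianReal a v = (gaussianReal 0 v).withDensity
      fun z => ENNReal.ofReal (Real.exp ((a * z - a ^ 2 / 2) / v)) := by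
  rw [gaussianReal_of_var_ne_zero _ hv, gaussianReal_of_var_ne_zero _ hv,
    ← withDensity_mul _ (measurable_gaussianPDF _ _) (by fun_prop)]
  congr 1
  ext z
  have hv' : (v : ℝ) ≠ 0 := by exact_mod_cast hv
  rw [Pi.mul_apply, gaussianPDF, gaussianPDF, ← ENNReal.ofReal_mul (gaussianPDFReal_nonneg _ _ _),
    gaussianPDFReal, gaussianPDFReal, mul_assoc _ (Real.exp _), ← Real.exp_add]
  congr 3
  field_simp
  ring

theorem pi_withDensity {ι : Type*} [Fintype ι] {α : ι → Type*} [∀ j, MeasurableSpace (α j)]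
    (μ : ∀ j, Measure (α j)) [∀ j, IsProbabilityMeasure (μ j)] (D : ∀ j, α j → ENNReal)
    (hD : ∀ j, Measurable (D j))
    [∀ j, SigmaFinite ((μ j).withDensity (D j))] :
    Measure.pi (fun j => (μ j).withDensity (D j))
      = (Measure.pi μ).withDensity fun z => ∏ j, D j (z j) := by
  refine Measure.pi_eq fun s hs => ?_
  rw [withDensity_apply _ (MeasurableSet.univ_pi hs),
    ← lintegral_indicator (MeasurableSet.univ_pi hs)]
  have h1 : (Set.univ.pi s).indicator (fun z : ∀ j, α j => ∏ j, D j (z j))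
      = fun z => ∏ j, (s j).indicator (D j) (z j) := by
    ext z
    by_cases hz : z ∈ Set.univ.pi s
    · rw [Set.indicator_of_mem hz]
      exact Finset.prod_congr rfl fun j _ => (Set.indicator_of_mem (hz j trivial) _).symm
    · rw [Set.indicator_of_notMem hz]
      obtain ⟨j, hj⟩ : ∃ j, z j ∉ s j := by simpa [Set.mem_univ_pi] using hz
      exact (Finset.prod_eq_zero (Finset.mem_univ j) (Set.indicator_of_notMem hj _)).symm
  have hm : ∀ j, Measurable ((s j).indicator (D j)) := fun j => (hD j).indicator (hs j)
  rw [h1, lintegral_prod_eq_prod_lintegral_of_indepFun Finset.univ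
    (fun j (z : ∀ j, α j) => (s j).indicator (D j) (z j))
    (iIndepFun_pi (X := fun j => (s j).indicator (D j)) fun j => (hm j).aemeasurable)
    (fun j => (hm j).comp (measurable_pi_apply j))]
  refine Finset.prod_congr rfl fun j _ => ?_
  rw [withDensity_apply _ (hs j), ← lintegral_indicator (hs j)]
  exact ((measurePreserving_eval μ j).lintegral_comp (hm j))

instance (r : ℕ) (v : ℝ) : IsProbabilityMeasure (noiseLaw r v) := by
  unfold noiseLaw; infer_instance

/-- The log density ratio of the translate of `noiseLaw r v` by `a` to `noiseLaw r v`. -/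
noncomputable def noiseLogRatio {r : ℕ} (v : ℝ) (a z : Fin r → ℝ) : ℝ :=
  ∑ j, (a j * z j - a j ^ 2 / 2) / v

theorem lintegral_noiseLaw_add {r : ℕ} {v : ℝ} (hv : 0 < v) (a : Fin r → ℝ)
    {g : (Fin r → ℝ) → ENNReal} (hg : Measurable g) :
    ∫⁻ z, g (z + a) ∂noiseLaw r v
      = ∫⁻ z, g z * ENNReal.ofReal (Real.exp (noiseLogRatio v a z)) ∂noiseLaw r v := by
  have hv' : v.toNNReal ≠ 0 := by simpa using hv
  have hD : ∀ j, Measurable fun z : ℝ => ENNReal.ofReal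
      (Real.exp ((a j * z - a j ^ 2 / 2) / v.toNNReal)) := fun j => by fun_prop
  have hmap : (noiseLaw r v).map (fun z => z + a)
      = Measure.pi fun j => gaussianReal (a j) v.toNNReal := by
    have h := Measure.pi_map_pi (μ := fun _ : Fin r => gaussianReal 0 v.toNNReal)
      (f := fun j x => x + a j) (hμ := fun j => by
        rw [gaussianReal_map_add_const]; infer_instance) (fun j => by fun_prop)
    simp only [gaussianReal_map_add_const, zero_add] at h
    exact h
  have hdens : (noiseLaw r v).map (fun z => z + a)
      = (noiseLaw r v).withDensity fun z => ∏ j, ENNReal.ofReal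
          (Real.exp ((a j * z j - a j ^ 2 / 2) / v.toNNReal)) := by
    have : ∀ j, SigmaFinite ((gaussianReal 0 v.toNNReal).withDensity fun z => ENNReal.ofReal
        (Real.exp ((a j * z - a j ^ 2 / 2) / v.toNNReal))) := fun j => by
      rw [← gaussianReal_eq_withDensity_exp _ hv']; infer_instance
    rw [hmap, noiseLaw, ← pi_withDensity _ _ hD]
    simp only [← gaussianReal_eq_withDensity_exp _ hv']
  rw [← lintegral_map hg (by fun_prop), hdens, lintegral_withDensity_eq_lintegral_mul _ (by
    exact Finset.measurable_fun_prod _ fun j _ => (hD j).comp (measurable_pi_apply j)) hg]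
  refine lintegral_congr fun z => ?_
  rw [Pi.mul_apply, mul_comm, ← ENNReal.ofReal_prod_of_nonneg fun j _ => (Real.exp_pos _).le,
    ← Real.exp_sum, noiseLogRatio, Real.coe_toNNReal _ hv.le]

theorem exp_mul_noiseLogRatio {r : ℕ} (v : ℝ) (a z : Fin r → ℝ) (c : ℝ) :
    Real.exp (c * noiseLogRatio v a z)
      = ∏ j, Real.exp (-(c * a j ^ 2 / (2 * v))) * Real.exp (c * a j / v * z j) := by
  rw [noiseLogRatio, Finset.mul_sum, Real.exp_sum]
  refine Finset.prod_congr rfl fun j _ => ?_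
  rw [← Real.exp_add]
  ring_nf

theorem isGaussianLogRatio_noiseLaw {r : ℕ} {v : ℝ} (hv : 0 < v) (a : Fin r → ℝ) :
    IsGaussianLogRatio (noiseLaw r v) (noiseLogRatio v a) ((∑ j, a j ^ 2) / (2 * v)) where
  measurable := by unfold noiseLogRatio; fun_prop
  nonneg := by positivity
  integrable c := by
    simp only [exp_mul_noiseLogRatio]
    exact Integrable.fintype_prod (f := fun j x => Real.exp (-(c * a j ^ 2 / (2 * v)))
      * Real.exp (c * a j / v * x)) fun j => (integrable_exp_mul_gaussianReal _).const_mul _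
  integral_eq c := by
    simp only [exp_mul_noiseLogRatio]
    rw [noiseLaw, integral_fintype_prod_eq_prod (𝕜 := ℝ) (fun j x =>
      Real.exp (-(c * a j ^ 2 / (2 * v))) * Real.exp (c * a j / v * x))]
    have hmgf : ∀ t, ∫ x, Real.exp (t * x) ∂gaussianReal 0 v.toNNReal
        = Real.exp (v * t ^ 2 / 2) := by
      intro t
      have := congrFun (mgf_id_gaussianReal (μ := 0) (v := v.toNNReal)) t
      simpa [mgf, Real.coe_toNNReal _ hv.le] using this
    simp only [integral_const_mul, hmgf]
    simp only [← Real.exp_add]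
    rw [← Real.exp_sum, Finset.sum_div, Finset.mul_sum]
    congr 1
    refine Finset.sum_congr rfl fun j _ => ?_
    field_simp
    ring

/-! ### Comparison of two Gaussian mixtures -/

theorem lintegral_rpow_one_div_le {Y : Type*} [MeasurableSpace Y] (ν : Measure Y)
    [IsProbabilityMeasure ν] {h : Y → ENNReal} (hh : Measurable h) {p : ℝ} (hp : 1 ≤ p) :
    ∫⁻ y, h y ^ (1 / p) ∂ν ≤ (∫⁻ y, h y ∂ν) ^ (1 / p) := by
  rcases hp.eq_or_lt with rfl | hp
  · simp
  have hp0 : p ≠ 0 := by linarith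
  have := ENNReal.lintegral_mul_le_Lp_mul_Lq ν (Real.HolderConjugate.conjExponent hp)
    (f := fun y => h y ^ (1 / p)) (g := 1) (hh.pow_const _).aemeasurable aemeasurable_const
  simpa [← ENNReal.rpow_mul, hp0] using this

namespace IsGaussianLogRatio

variable {Ω : Type*} [MeasurableSpace Ω] {μ : Measure Ω} {ξ : Ω → ℝ} {σ q : ℝ}

/-- Passage from the mixture to `μ`, at the cost of one exponent `p`. -/
theorem lintegral_mul_mixtureDensity_le (h : IsGaussianLogRatio μ ξ σ) (hq0 : 0 ≤ q) (hq1 : q ≤ 1)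
    {m : ℕ} {p : ℝ} (hp : p.HolderConjugate m) (hm : m * σ ≤ 1) {G : Ω → ENNReal}
    (hG : Measurable G) :
    ∫⁻ x, G x * ENNReal.ofReal (mixtureDensity q ξ x) ∂μ
      ≤ ENNReal.ofReal (Real.exp (114 * (m * q ^ 2 * σ))) * (∫⁻ x, G x ^ p ∂μ) ^ (1 / p) := by
  have hm0 : (m : ℝ) ≠ 0 := hp.symm.ne_zero
  have h1 := ENNReal.lintegral_mul_le_Lp_mul_Lq μ hp hG.aemeasurable
    (g := fun x => ENNReal.ofReal (mixtureDensity q ξ x))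
    h.measurable_mixtureDensity.ennreal_ofReal.aemeasurable
  simp only [Pi.mul_apply] at h1
  refine h1.trans ?_
  rw [mul_comm]
  gcongr
  simp only [ENNReal.rpow_natCast]
  calc _ = (∫⁻ x, ENNReal.ofReal (mixtureDensity q ξ x ^ m) ∂μ) ^ (1 / (m : ℝ)) := by
        congr 2
        ext x
        rw [ENNReal.ofReal_pow (mixtureDensity_pos hq0 hq1 ξ x).le]
    _ ≤ (ENNReal.ofReal (Real.exp (114 * (m ^ 2 * q ^ 2 * σ)))) ^ (1 / (m : ℝ)) := by
        gcongr
        exact h.lintegral_mixtureDensity_pow_le hq0 hq1 hm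
    _ = _ := by
        rw [ENNReal.ofReal_rpow_of_pos (Real.exp_pos _), ← Real.exp_mul]
        congr 2
        field_simp

/-- Passage from `μ` to the mixture, at the cost of one exponent `p`. -/
theorem lintegral_le_lintegral_mul_mixtureDensity (h : IsGaussianLogRatio μ ξ σ) (hq0 : 0 ≤ q)
    (hq1 : q ≤ 1) (hσ : 2 * σ ≤ 1) {m : ℕ} {p : ℝ} (hp : p.HolderConjugate m) {G : Ω → ENNReal}
    (hG : Measurable G) :
    ∫⁻ x, G x ∂μ ≤ ENNReal.ofReal (Real.exp (12 * (m * q ^ 2 * σ))) *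
      (∫⁻ x, G x ^ p * ENNReal.ofReal (mixtureDensity q ξ x) ∂μ) ^ (1 / p) := by
  have hm0 : (m : ℝ) ≠ 0 := hp.symm.ne_zero
  have hp0 : p ≠ 0 := hp.ne_zero
  have hσ0 := h.nonneg
  obtain ⟨n, rfl⟩ : ∃ n, m = n + 1 := ⟨m - 1, by
    have : m ≠ 0 := by exact_mod_cast hm0
    omega⟩
  set D : Ω → ENNReal := fun x => ENNReal.ofReal (mixtureDensity q ξ x) with hD
  have hDm : Measurable D := h.measurable_mixtureDensity.ennreal_ofReal
  have hD0 : ∀ x, D x ≠ 0 := fun x => by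
    simpa [hD] using mixtureDensity_pos hq0 hq1 ξ x
  have hDt : ∀ x, D x ≠ ⊤ := fun x => ENNReal.ofReal_ne_top
  have hpn : 1 / p * ((n + 1 : ℕ) : ℝ) = n := by
    have h2 := hp.inv_add_inv_eq_one
    push_cast at h2 hm0 ⊢
    field_simp at h2 ⊢
    linarith
  -- Hölder for `G = (G D^{1/p}) · D^{-1/p}`; the second factor to the power `m` is `D^{-(m - 1)}`.
  have h1 := ENNReal.lintegral_mul_le_Lp_mul_Lq μ hp (f := fun x => G x * D x ^ (1 / p))
    (g := fun x => D x ^ (-(1 / p))) (hG.mul (hDm.pow_const _)).aemeasurable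
    (hDm.pow_const _).aemeasurable
  have e1 : ∀ x, G x * D x ^ (1 / p) * D x ^ (-(1 / p)) = G x := fun x => by
    rw [mul_assoc, ← ENNReal.rpow_add _ _ (hD0 x) (hDt x)]; simp
  have e2 : ∀ x, (G x * D x ^ (1 / p)) ^ p = G x ^ p * D x := fun x => by
    rw [ENNReal.mul_rpow_of_nonneg _ _ hp.nonneg, ← ENNReal.rpow_mul]; simp [hp0]
  have e3 : ∀ x, (D x ^ (-(1 / p))) ^ ((n + 1 : ℕ) : ℝ)
      = ENNReal.ofReal ((mixtureDensity q ξ x)⁻¹ ^ n) := fun x => by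
    have hpos := mixtureDensity_pos hq0 hq1 ξ x
    rw [← ENNReal.rpow_mul, neg_mul, hpn, ENNReal.rpow_neg, ENNReal.rpow_natCast,
      ENNReal.ofReal_pow (inv_nonneg.2 hpos.le), ENNReal.ofReal_inv_of_pos hpos, ENNReal.inv_pow]
  simp only [Pi.mul_apply, e1, e2, e3] at h1
  refine h1.trans ?_
  rw [mul_comm]
  gcongr
  calc _ ≤ (ENNReal.ofReal (Real.exp (12 * (n ^ 2 * q ^ 2 * σ)))) ^ (1 / ((n + 1 : ℕ) : ℝ)) := by
        gcongr
        exact h.lintegral_mixtureDensity_inv_pow_le hq0 hq1 hσ n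
    _ ≤ _ := by
        rw [ENNReal.ofReal_rpow_of_pos (Real.exp_pos _), ← Real.exp_mul]
        apply ENNReal.ofReal_le_ofReal
        apply Real.exp_le_exp.2
        push_cast
        rw [mul_one_div, div_le_iff₀ (by positivity)]
        have hn : (n : ℝ) ^ 2 ≤ (n + 1) * (n + 1) := by nlinarith [n.cast_nonneg (α := ℝ)]
        have := mul_le_mul_of_nonneg_right hn (mul_nonneg (sq_nonneg q) hσ0)
        nlinarith

/-- Two mixtures with the same base measure are compared through it; the exponents multiply. -/
theorem lintegral_mixture_le {ζ : Ω → ℝ} {σ₁ σ₂ : ℝ} (h₁ : IsGaussianLogRatio μ ξ σ₁)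
    (h₂ : IsGaussianLogRatio μ ζ σ₂) (hσ₁ : σ₁ ≤ σ) (hσ₂ : σ₂ ≤ σ) (hq0 : 0 ≤ q) (hq1 : q ≤ 1)
    {m : ℕ} {p : ℝ} (hp : p.HolderConjugate m) (hm : m * σ ≤ 1) {G : Ω → ENNReal}
    (hG : Measurable G) :
    ∫⁻ x, G x * ENNReal.ofReal (mixtureDensity q ξ x) ∂μ
      ≤ ENNReal.ofReal (Real.exp (126 * (m * q ^ 2 * σ))) *
        (∫⁻ x, G x ^ (p * p) * ENNReal.ofReal (mixtureDensity q ζ x) ∂μ) ^ (1 / (p * p)) := by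
  have hσ0 : 0 ≤ σ := h₁.nonneg.trans hσ₁
  have hm2 : (2 : ℝ) ≤ m := by
    have : 1 < m := by exact_mod_cast hp.symm.lt
    exact_mod_cast this
  have hp1 : 1 / p ≤ 1 := by
    rw [div_le_one hp.pos]; exact hp.lt.le
  have hp0 : 0 ≤ 1 / p := by have := hp.nonneg; positivity
  have hA := h₁.lintegral_mul_mixtureDensity_le hq0 hq1 hp
    ((mul_le_mul_of_nonneg_left hσ₁ (by positivity)).trans hm) hG
  have hB := h₂.lintegral_le_lintegral_mul_mixtureDensity hq0 hq1 (by nlinarith) hp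
    (hG.pow_const p)
  have hone : (1 : ENNReal) ≤ ENNReal.ofReal (Real.exp (12 * (m * q ^ 2 * σ))) := by
    rw [ENNReal.one_le_ofReal]
    exact Real.one_le_exp (by positivity)
  have hB' : (∫⁻ x, G x ^ p ∂μ) ^ (1 / p) ≤ ENNReal.ofReal (Real.exp (12 * (m * q ^ 2 * σ))) *
      (∫⁻ x, G x ^ (p * p) * ENNReal.ofReal (mixtureDensity q ζ x) ∂μ) ^ (1 / (p * p)) := by
    calc _ ≤ (ENNReal.ofReal (Real.exp (12 * (m * q ^ 2 * σ₂))) * (∫⁻ x, (G x ^ p) ^ p *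
          ENNReal.ofReal (mixtureDensity q ζ x) ∂μ) ^ (1 / p)) ^ (1 / p) :=
          ENNReal.rpow_le_rpow hB hp0
      _ = ENNReal.ofReal (Real.exp (12 * (m * q ^ 2 * σ₂))) ^ (1 / p) * (∫⁻ x, G x ^ (p * p) *
          ENNReal.ofReal (mixtureDensity q ζ x) ∂μ) ^ (1 / (p * p)) := by
          rw [ENNReal.mul_rpow_of_nonneg _ _ hp0, ← ENNReal.rpow_mul, one_div_mul_one_div]
          simp only [ENNReal.rpow_mul]
      _ ≤ _ := by
          gcongr
          calc _ ≤ ENNReal.ofReal (Real.exp (12 * (m * q ^ 2 * σ))) ^ (1 / p) := by gcongr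
            _ ≤ _ := (ENNReal.rpow_le_rpow_of_exponent_le hone hp1).trans_eq (ENNReal.rpow_one _)
  calc _ ≤ _ := hA
    _ ≤ ENNReal.ofReal (Real.exp (114 * (m * q ^ 2 * σ))) *
        (ENNReal.ofReal (Real.exp (12 * (m * q ^ 2 * σ))) * (∫⁻ x, G x ^ (p * p) *
          ENNReal.ofReal (mixtureDensity q ζ x) ∂μ) ^ (1 / (p * p))) := by gcongr
    _ = _ := by
      rw [← mul_assoc, ← ENNReal.ofReal_mul (Real.exp_pos _).le, ← Real.exp_add]
      ring_nf

end IsGaussianLogRatio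

/-- The comparison of `(1 - q) N(0, v I) + q N(a, v I)` with `(1 - q) N(0, v I) + q N(b, v I)`. -/
theorem lintegral_coin_noiseLaw_le {r : ℕ} {v q σ : ℝ} (hv : 0 < v) (hq0 : 0 ≤ q) (hq1 : q ≤ 1)
    {a b : Fin r → ℝ} (ha : ∑ j, a j ^ 2 ≤ 2 * v * σ) (hb : ∑ j, b j ^ 2 ≤ 2 * v * σ)
    {m : ℕ} {p : ℝ} (hp : p.HolderConjugate m) (hm : m * σ ≤ 1) {g : (Fin r → ℝ) → ENNReal}
    (hg : Measurable g) :
    ENNReal.ofReal q * ∫⁻ z, g (z + a) ∂noiseLaw r v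
        + ENNReal.ofReal (1 - q) * ∫⁻ z, g z ∂noiseLaw r v
      ≤ ENNReal.ofReal (Real.exp (126 * (m * q ^ 2 * σ))) *
        (ENNReal.ofReal q * ∫⁻ z, g (z + b) ^ (p * p) ∂noiseLaw r v
          + ENNReal.ofReal (1 - q) * ∫⁻ z, g z ^ (p * p) ∂noiseLaw r v) ^ (1 / (p * p)) := by
  have key : ∀ (c : Fin r → ℝ) (f : (Fin r → ℝ) → ENNReal), Measurable f →
      ENNReal.ofReal q * ∫⁻ z, f (z + c) ∂noiseLaw r v
        + ENNReal.ofReal (1 - q) * ∫⁻ z, f z ∂noiseLaw r v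
      = ∫⁻ z, f z * ENNReal.ofReal (mixtureDensity q (noiseLogRatio v c) z) ∂noiseLaw r v := by
    intro c f hf
    have hc := (isGaussianLogRatio_noiseLaw hv c).measurable
    rw [lintegral_noiseLaw_add hv c hf, ← lintegral_const_mul _ (by fun_prop),
      ← lintegral_const_mul _ hf, ← lintegral_add_left (by fun_prop)]
    refine lintegral_congr fun z => ?_
    rw [mixtureDensity, ENNReal.ofReal_add (by linarith) (by positivity), ENNReal.ofReal_mul hq0]
    ring
  rw [key a g hg, key b (fun z => g z ^ (p * p)) (hg.pow_const _)]
  refine (isGaussianLogRatio_noiseLaw hv a).lintegral_mixture_le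
    (isGaussianLogRatio_noiseLaw hv b) ?_ ?_ hq0 hq1 hp hm hg
  · rw [div_le_iff₀ (by positivity)]; linarith
  · rw [div_le_iff₀ (by positivity)]; linarith

/-! ### Hölder domination and composition -/

/-- The dual form of a Rényi-divergence bound between the laws of `f` and `f'` under `μ`: if `s` is
conjugate to `α`, it says that the Rényi divergence of order `α` of the law of `f` from that of `f'`
is at most `α / (α - 1) · log B`. -/
def HolderDominated {Ω Y : Type*} [MeasurableSpace Ω] [MeasurableSpace Y] (μ : Measure Ω)
    (f f' : Ω → Y) (B : ENNReal) (s : ℝ) : Prop :=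
  ∀ g : Y → ENNReal, Measurable g →
    ∫⁻ ω, g (f ω) ∂μ ≤ B * (∫⁻ ω, g (f' ω) ^ s ∂μ) ^ (1 / s)

theorem lintegral_pi_insertNth {n : ℕ} {W : Type*} [MeasurableSpace W] (ν : Measure W)
    [SigmaFinite ν] (i : Fin (n + 1)) {f : (Fin (n + 1) → W) → ENNReal} (hf : Measurable f) :
    ∫⁻ ws, f ws ∂Measure.pi (fun _ => ν)
      = ∫⁻ w, ∫⁻ ws, f (i.insertNth w ws) ∂Measure.pi (fun _ : Fin n => ν) ∂ν := by
  have h := (measurePreserving_piFinSuccAbove (fun _ : Fin (n + 1) => ν) i).symm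
  rw [← h.lintegral_comp hf]
  exact lintegral_prod _ (hf.comp h.measurable).aemeasurable

/-- The path started at `x` and driven by the inputs `ws` through the update `F`, including its
starting point. -/
def trajectory {E W : Type*} {T : ℕ} (F : E → W → E) (x : E) (ws : Fin T → W) : Fin (T + 1) → E :=
  Fin.induction x fun t θ => F θ (ws t)

theorem trajectory_cons {E W : Type*} {T : ℕ} (F : E → W → E) (x : E) (w : W) (ws : Fin T → W) :
    trajectory F x (Fin.cons w ws : Fin (T + 1) → W) = Fin.cons x (trajectory F (F x w) ws) := by
  ext i
  refine Fin.cases rfl (fun j => ?_) i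
  rw [Fin.cons_succ]
  induction j using Fin.induction with
  | zero => rfl
  | succ j ih =>
    rw [trajectory, Fin.induction_succ, Fin.cons_succ]
    exact congrArg (F · (ws j)) ih

theorem measurable_trajectory {E W : Type*} [MeasurableSpace E] [MeasurableSpace W] {T : ℕ}
    {F : E → W → E} (hF : Measurable (Function.uncurry F)) :
    Measurable fun y : E × (Fin T → W) => trajectory F y.1 y.2 := by
  refine measurable_pi_lambda _ fun i => ?_
  induction i using Fin.induction with
  | zero => exact measurable_fst
  | succ j ih => exact hF.comp (ih.prodMk ((measurable_pi_apply j).comp measurable_snd))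

/-- Adaptive composition: a one-step domination that is uniform in the current state extends to
whole trajectories, with the constants multiplied. -/
theorem HolderDominated.pi_trajectory {E W : Type*} [MeasurableSpace E] [MeasurableSpace W]
    {ν : Measure W} [IsProbabilityMeasure ν] {F F' : E → W → E}
    (hF : Measurable (Function.uncurry F)) (hF' : Measurable (Function.uncurry F')) {B : ENNReal}
    {s : ℝ} (hs : 1 ≤ s) (hstep : ∀ x, HolderDominated ν (F x) (F' x) B s) (T : ℕ) (x : E) :
    HolderDominated (Measure.pi fun _ : Fin T => ν) (trajectory F x) (trajectory F' x)
      (B ^ T) s := by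
  have hs0 : s ≠ 0 := by linarith
  have hs1 : 0 ≤ 1 / s := by positivity
  have hmeas : ∀ {F : E → W → E}, Measurable (Function.uncurry F) → ∀ {T : ℕ} (x : E),
      Measurable (trajectory (T := T) F x) :=
    fun h T x => (measurable_trajectory h).comp measurable_prodMk_left
  induction T generalizing x with
  | zero =>
    intro g hg
    have e : ∀ (F : E → W → E) (ws : Fin 0 → W), trajectory F x ws = fun _ => x := by
      intro F ws
      ext i
      exact Fin.cases rfl (fun j => j.elim0) i
    simp [e, ← ENNReal.rpow_mul, hs0]
  | succ T ih =>
    intro g hg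
    have hcons : Measurable fun y : Fin (T + 1) → E => g (Fin.cons x y) := by
      refine hg.comp (measurable_pi_lambda _ fun i => ?_)
      refine Fin.cases ?_ (fun j => ?_) i
      · exact measurable_const
      · exact measurable_pi_apply j
    rw [lintegral_pi_insertNth ν 0 (f := fun ws => g (trajectory F x ws))
        (hg.comp (hmeas hF x)),
      lintegral_pi_insertNth ν 0 (f := fun ws => g (trajectory F' x ws) ^ s)
        ((hg.comp (hmeas hF' x)).pow_const s)]
    simp only [Fin.insertNth_zero', trajectory_cons]
    -- The first step is peeled off; `h` is the bound the others give for each second state.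
    set h : E → ENNReal := fun y =>
      (∫⁻ ws, g (Fin.cons x (trajectory F' y ws)) ^ s ∂Measure.pi fun _ : Fin T => ν) ^ (1 / s)
      with hh
    have hhm : Measurable h :=
      (Measurable.lintegral_prod_right
        ((hcons.comp (measurable_trajectory hF')).pow_const s)).pow_const _
    calc _ ≤ ∫⁻ w, B ^ T * h (F x w) ∂ν := lintegral_mono fun w => ih (F x w) _ hcons
      _ = B ^ T * ∫⁻ w, h (F x w) ∂ν :=
        lintegral_const_mul _ (hhm.comp (hF.comp measurable_prodMk_left))
      _ ≤ B ^ T * (B * (∫⁻ w, h (F' x w) ^ s ∂ν) ^ (1 / s)) := by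
        gcongr
        exact hstep x h hhm
      _ = _ := by
        rw [← mul_assoc, ← pow_succ]
        simp only [hh, ← ENNReal.rpow_mul, one_div_mul_cancel hs0, ENNReal.rpow_one]

/-- Domination conditionally on shared randomness implies domination. -/
theorem HolderDominated.prod {E Z Y : Type*} [MeasurableSpace E] [MeasurableSpace Z]
    [MeasurableSpace Y] {μ : Measure E} [IsProbabilityMeasure μ] {ν : Measure Z} [SFinite ν]
    {f f' : E → Z → Y} (hf : Measurable (Function.uncurry f))
    (hf' : Measurable (Function.uncurry f')) {B : ENNReal} {s : ℝ} (hs : 1 ≤ s)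
    (h : ∀ x, HolderDominated ν (f x) (f' x) B s) :
    HolderDominated (μ.prod ν) (Function.uncurry f) (Function.uncurry f') B s := by
  intro g hg
  have hm : Measurable fun x => ∫⁻ z, g (f' x z) ^ s ∂ν :=
    Measurable.lintegral_prod_right ((hg.comp hf').pow_const s)
  rw [lintegral_prod (fun y => g (Function.uncurry f y)) (hg.comp hf).aemeasurable,
    lintegral_prod (fun y => g (Function.uncurry f' y) ^ s)
      ((hg.comp hf').pow_const s).aemeasurable]
  calc _ ≤ ∫⁻ x, B * (∫⁻ z, g (f' x z) ^ s ∂ν) ^ (1 / s) ∂μ := lintegral_mono fun x => h x g hg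
    _ = B * ∫⁻ x, (∫⁻ z, g (f' x z) ^ s ∂ν) ^ (1 / s) ∂μ :=
      lintegral_const_mul _ (hm.pow_const _)
    _ ≤ _ := by
      gcongr
      exact lintegral_rpow_one_div_le μ hm hs

/-! ### One iteration of the algorithm -/

theorem isProbabilityMeasure_coinLaw {q : ℝ} (hq0 : 0 ≤ q) (hq1 : q ≤ 1) :
    IsProbabilityMeasure (coinLaw q) := by
  refine ⟨?_⟩
  simp [coinLaw, ← ENNReal.ofReal_add hq0 (sub_nonneg.2 hq1)]

theorem lintegral_coinLaw (q : ℝ) (f : Bool → ENNReal) :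
    ∫⁻ b, f b ∂coinLaw q = ENNReal.ofReal q * f true + ENNReal.ofReal (1 - q) * f false := by
  simp [coinLaw, lintegral_add_measure, lintegral_smul_measure, smul_eq_mul]

/-- No regularity of `f` is needed: the derivative, read as `0` where it does not exist, is always
measurable. -/
theorem measurable_gradient {r : ℕ} (f : EuclideanSpace ℝ (Fin r) → ℝ) :
    Measurable (gradient f) :=
  (InnerProductSpace.toDual ℝ _).symm.continuous.measurable.comp (measurable_fderiv ℝ f)

theorem measurable_clip {r : ℕ} (L : ℝ) : Measurable (clip (r := r) L) := by
  unfold clip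
  fun_prop

theorem norm_clip_le {r : ℕ} {L : ℝ} (hL : 0 < L) (g : EuclideanSpace ℝ (Fin r)) :
    ‖clip L g‖ ≤ L := by
  have h1 : 0 < max 1 (‖g‖ / L) := lt_max_of_lt_left one_pos
  rw [clip, norm_smul, norm_inv, Real.norm_of_nonneg h1.le, inv_mul_le_iff₀ h1]
  exact (div_le_iff₀ hL).1 (le_max_right _ _)

theorem measurable_sgldStep {𝒳 : Type*} {N r : ℕ} (p : EuclideanSpace ℝ (Fin r) → ℝ)
    (lik : 𝒳 → EuclideanSpace ℝ (Fin r) → ℝ) (L : ℝ) (τ : ℕ) (X : Fin N → 𝒳) (η : ℝ) :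
    Measurable (Function.uncurry fun θ (w : (Fin N → Bool) × (Fin r → ℝ)) =>
      sgldStep p lik L τ X η θ w.1 w.2) := by
  have hprior := measurable_gradient fun ϑ => Real.log (p ϑ)
  have hlik : ∀ i, Measurable fun θ => clip L (gradient (fun ϑ => Real.log (lik (X i) ϑ)) θ) :=
    fun i => (measurable_clip L).comp (measurable_gradient fun ϑ => Real.log (lik (X i) ϑ))
  have hsum : Measurable fun y : EuclideanSpace ℝ (Fin r) × (Fin N → Bool) × (Fin r → ℝ) =>
      ∑ i, if y.2.1 i = true then clip L (gradient (fun ϑ => Real.log (lik (X i) ϑ)) y.1)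
        else 0 := by
    refine Finset.measurable_fun_sum _ fun i _ => Measurable.ite ?_ ?_ measurable_const
    · have : Measurable fun y : EuclideanSpace ℝ (Fin r) × (Fin N → Bool) × (Fin r → ℝ) =>
          y.2.1 i := by fun_prop
      exact this (measurableSet_singleton true)
    · exact (hlik i).comp measurable_fst
  simp only [sgldStep, Finset.sum_filter, Function.uncurry_def]
  fun_prop

/-- Including record `i` in the minibatch translates the noise. -/
theorem sgldStep_insertNth {𝒳 : Type*} {n r : ℕ} (p : EuclideanSpace ℝ (Fin r) → ℝ)
    (lik : 𝒳 → EuclideanSpace ℝ (Fin r) → ℝ) (L : ℝ) (τ : ℕ) (X : Fin (n + 1) → 𝒳) (η : ℝ)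
    (θ : EuclideanSpace ℝ (Fin r)) (i : Fin (n + 1)) (J : Fin n → Bool) (z : Fin r → ℝ) :
    sgldStep p lik L τ X η θ (i.insertNth true J) z
      = sgldStep p lik L τ X η θ (i.insertNth false J) (z + (-(η * (τ : ℝ)⁻¹) •
          clip L (gradient (fun ϑ => Real.log (lik (X i) ϑ)) θ)).ofLp) := by
  simp only [sgldStep, Finset.sum_filter, Fin.sum_univ_succAbove _ i, Fin.insertNth_apply_same,
    Fin.insertNth_apply_succAbove, WithLp.toLp_add, WithLp.toLp_ofLp, if_true, Bool.false_eq_true,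
    if_false, zero_add]
  module

theorem sgldStep_insertNth_false_congr {𝒳 : Type*} {n r : ℕ} (p : EuclideanSpace ℝ (Fin r) → ℝ)
    (lik : 𝒳 → EuclideanSpace ℝ (Fin r) → ℝ) (L : ℝ) (τ : ℕ) {X X' : Fin (n + 1) → 𝒳} (η : ℝ)
    (θ : EuclideanSpace ℝ (Fin r)) {i : Fin (n + 1)} (h : ∀ j, j ≠ i → X j = X' j)
    (J : Fin n → Bool) (z : Fin r → ℝ) :
    sgldStep p lik L τ X η θ (i.insertNth false J) z
      = sgldStep p lik L τ X' η θ (i.insertNth false J) z := by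
  simp only [sgldStep, Finset.sum_filter, Fin.sum_univ_succAbove _ i, Fin.insertNth_apply_same,
    Bool.false_eq_true, if_false, h _ (Fin.succAbove_ne i _)]

theorem lintegral_minibatchLaw_prod_noiseLaw {n r : ℕ} {q v : ℝ} (hq0 : 0 ≤ q) (hq1 : q ≤ 1)
    (i : Fin (n + 1)) {f : (Fin (n + 1) → Bool) × (Fin r → ℝ) → ENNReal} (hf : Measurable f) :
    ∫⁻ w, f w ∂(minibatchLaw (n + 1) q).prod (noiseLaw r v)
      = ∫⁻ J, (ENNReal.ofReal q * ∫⁻ z, f (i.insertNth true J, z) ∂noiseLaw r v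
          + ENNReal.ofReal (1 - q) * ∫⁻ z, f (i.insertNth false J, z) ∂noiseLaw r v)
        ∂minibatchLaw n q := by
  have := isProbabilityMeasure_coinLaw hq0 hq1
  rw [lintegral_prod _ hf.aemeasurable, minibatchLaw,
    lintegral_pi_insertNth (coinLaw q) i (Measurable.of_discrete), lintegral_coinLaw,
    minibatchLaw, lintegral_add_left (Measurable.of_discrete),
    lintegral_const_mul _ (Measurable.of_discrete), lintegral_const_mul _ (Measurable.of_discrete)]

/-- Domination for two maps of minibatch and noise that agree when record `i` is left out, and whose
noise is translated by `a`, respectively `b`, when it is included. -/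
theorem holderDominated_minibatch {n r : ℕ} {Y : Type*} [MeasurableSpace Y] {q v σ : ℝ}
    (hv : 0 < v) (hq0 : 0 ≤ q) (hq1 : q ≤ 1) {a b : Fin r → ℝ} (ha : ∑ j, a j ^ 2 ≤ 2 * v * σ)
    (hb : ∑ j, b j ^ 2 ≤ 2 * v * σ) {m : ℕ} {s : ℝ} (hs : s.HolderConjugate m) (hm : m * σ ≤ 1)
    (i : Fin (n + 1)) {f f' : (Fin (n + 1) → Bool) × (Fin r → ℝ) → Y} (hf : Measurable f)
    (hf' : Measurable f') (hft : ∀ J z, f (i.insertNth true J, z) = f (i.insertNth false J, z + a))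
    (hft' : ∀ J z, f' (i.insertNth true J, z) = f (i.insertNth false J, z + b))
    (hff' : ∀ J z, f' (i.insertNth false J, z) = f (i.insertNth false J, z)) :
    HolderDominated ((minibatchLaw (n + 1) q).prod (noiseLaw r v)) f f'
      (ENNReal.ofReal (Real.exp (126 * (m * q ^ 2 * σ)))) (s * s) := by
  intro g hg
  have hprob := isProbabilityMeasure_coinLaw hq0 hq1
  have hprob' : IsProbabilityMeasure (minibatchLaw n q) := by unfold minibatchLaw; infer_instance
  have hs1 : 1 ≤ s * s := by nlinarith [hs.lt]
  rw [lintegral_minibatchLaw_prod_noiseLaw hq0 hq1 i (f := fun w => g (f w)) (hg.comp hf),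
    lintegral_minibatchLaw_prod_noiseLaw hq0 hq1 i (f := fun w => g (f' w) ^ (s * s))
      ((hg.comp hf').pow_const _)]
  simp only [hft, hft', hff']
  set B := ENNReal.ofReal (Real.exp (126 * (m * q ^ 2 * σ)))
  set Ψ : (Fin n → Bool) → ENNReal := fun J =>
    ENNReal.ofReal q * ∫⁻ z, g (f (i.insertNth false J, z + b)) ^ (s * s) ∂noiseLaw r v
      + ENNReal.ofReal (1 - q) * ∫⁻ z, g (f (i.insertNth false J, z)) ^ (s * s) ∂noiseLaw r v
  calc _ ≤ ∫⁻ J, B * Ψ J ^ (1 / (s * s)) ∂minibatchLaw n q := lintegral_mono fun J =>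
        lintegral_coin_noiseLaw_le hv hq0 hq1 ha hb hs hm
          (g := fun z => g (f (i.insertNth false J, z)))
          (hg.comp (hf.comp measurable_prodMk_left))
    _ = B * ∫⁻ J, Ψ J ^ (1 / (s * s)) ∂minibatchLaw n q :=
        lintegral_const_mul _ Measurable.of_discrete
    _ ≤ B * (∫⁻ J, Ψ J ∂minibatchLaw n q) ^ (1 / (s * s)) := by
        gcongr
        exact lintegral_rpow_one_div_le _ Measurable.of_discrete hs1

/-- One iteration on adjacent datasets. The constant is free of `τ`: the translation has length at
most `η L / τ`, which the sampling probability `τ / N` compensates. -/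
theorem holderDominated_sgldStep {𝒳 : Type*} {N r τ : ℕ} (hτ : τ ≤ N) (hτ0 : 0 < τ)
    (p : EuclideanSpace ℝ (Fin r) → ℝ) (lik : 𝒳 → EuclideanSpace ℝ (Fin r) → ℝ) {L : ℝ}
    (hL : 0 < L) {X X' : Fin N → 𝒳} (h : AdjacentDatasets X X') {η : ℝ} (hη : 0 < η) {m : ℕ}
    {s : ℝ} (hs : s.HolderConjugate m) (hm : m * (L ^ 2 * η * N / (2 * τ ^ 2)) ≤ 1)
    (θ : EuclideanSpace ℝ (Fin r)) :
    HolderDominated ((minibatchLaw N ((τ : ℝ) / N)).prod (noiseLaw r (η / N)))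
      (fun w => sgldStep p lik L τ X η θ w.1 w.2) (fun w => sgldStep p lik L τ X' η θ w.1 w.2)
      (ENNReal.ofReal (Real.exp (63 * (m * (L ^ 2 * η / N))))) (s * s) := by
  obtain ⟨i, -, hX⟩ := h
  have hτR : (0 : ℝ) < τ := by exact_mod_cast hτ0
  have hNR : (0 : ℝ) < N := by exact_mod_cast hτ0.trans_le hτ
  obtain ⟨n, rfl⟩ : ∃ n, N = n + 1 := ⟨N - 1, by have := i.pos; omega⟩
  have hmeas : ∀ X : Fin (n + 1) → 𝒳, Measurable fun w : (Fin (n + 1) → Bool) × (Fin r → ℝ) =>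
      sgldStep p lik L τ X η θ w.1 w.2 := fun X =>
    (measurable_sgldStep p lik L τ X η).comp measurable_prodMk_left
  have hshift : ∀ X : Fin (n + 1) → 𝒳, ∑ j, ((-(η * (τ : ℝ)⁻¹) •
      clip L (gradient (fun ϑ => Real.log (lik (X i) ϑ)) θ)).ofLp j) ^ 2
      ≤ 2 * (η / (n + 1 : ℕ)) * (L ^ 2 * η * (n + 1 : ℕ) / (2 * τ ^ 2)) := by
    intro X
    rw [← EuclideanSpace.real_norm_sq_eq, norm_smul, norm_neg,
      Real.norm_of_nonneg (by positivity), mul_pow]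
    calc _ ≤ (η * (τ : ℝ)⁻¹) ^ 2 * L ^ 2 := by
          gcongr
          exact norm_clip_le hL _
      _ = _ := by field_simp
  have hconst : 63 * (m * (L ^ 2 * η / (n + 1 : ℕ)))
      = 126 * (m * ((τ : ℝ) / (n + 1 : ℕ)) ^ 2 * (L ^ 2 * η * (n + 1 : ℕ) / (2 * τ ^ 2))) := by
    field_simp
    ring
  rw [hconst]
  refine holderDominated_minibatch (div_pos hη hNR) (by positivity)
    ((div_le_one hNR).2 (by exact_mod_cast hτ)) (hshift X) (hshift X') hs hm i (hmeas X) (hmeas X')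
    (fun J z => sgldStep_insertNth p lik L τ X η θ i J z) (fun J z => ?_)
    (fun J z => (sgldStep_insertNth_false_congr p lik L τ η θ hX J z).symm)
  exact (sgldStep_insertNth p lik L τ X' η θ i J z).trans
    (sgldStep_insertNth_false_congr p lik L τ η θ hX J _).symm

/-! ### From domination to differential privacy -/

/-- The two terms on the right cover the cases `x ≥ e^{-ε / (2 β)}` and `x < e^{-ε / (2 β)}`. -/
theorem mul_rpow_le_exp_mul_add {x β C ε δ : ℝ} (hx : 0 ≤ x) (hβ0 : 0 < β) (hβ1 : β < 1)
    (hC : C ≤ Real.exp (ε / 2)) (hδ0 : 0 < δ) (hδ : Real.exp (ε - ε / (2 * β)) ≤ δ) :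
    C * x ^ (1 - β) ≤ Real.exp ε * x + δ := by
  have hxr : 0 ≤ x ^ (1 - β) := Real.rpow_nonneg hx _
  refine (mul_le_mul_of_nonneg_right hC hxr).trans ?_
  rcases le_or_gt (Real.exp (-(ε / (2 * β)))) x with h | h
  · have hx0 : 0 < x := (Real.exp_pos _).trans_le h
    have h1 : x ^ (-β) ≤ Real.exp (ε / 2) := by
      calc _ ≤ Real.exp (-(ε / (2 * β))) ^ (-β) :=
            Real.rpow_le_rpow_of_nonpos (Real.exp_pos _) h (by linarith)
        _ = _ := by
          rw [← Real.exp_mul]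
          congr 1
          field_simp
    calc _ = Real.exp (ε / 2) * (x * x ^ (-β)) := by
          rw [sub_eq_add_neg, Real.rpow_add hx0, Real.rpow_one]
      _ ≤ Real.exp (ε / 2) * (x * Real.exp (ε / 2)) := by gcongr
      _ = Real.exp (ε / 2 + ε / 2) * x := by rw [Real.exp_add]; ring
      _ ≤ _ := by rw [add_halves]; linarith
  · calc _ ≤ Real.exp (ε / 2) * Real.exp (-(ε / (2 * β))) ^ (1 - β) := by
          gcongr
      _ = Real.exp (ε - ε / (2 * β)) := by
          rw [← Real.exp_mul, ← Real.exp_add]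
          congr 1
          field_simp
          ring
      _ ≤ _ := by
          have := mul_nonneg (Real.exp_pos ε).le hx
          linarith

/-- The choice of the order `m`: at least `4 ℓ / ε + 4`, and at most a constant times `ℓ / ε`. -/
theorem exists_order {K ε ℓ : ℝ} (hε : 0 < ε) (hK : ε ≤ K * ℓ) (hℓ : 0 < ℓ) :
    ∃ m : ℕ, 4 ≤ m ∧ ε - ε * m / 4 ≤ -ℓ ∧ m * ε ≤ (4 + 5 * K) * ℓ := by
  refine ⟨⌈4 * ℓ / ε⌉₊ + 4, by omega, ?_, ?_⟩
  · have h1 := (div_le_iff₀ hε).1 (Nat.le_ceil (4 * ℓ / ε))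
    push_cast
    linarith
  · have h1 := (Nat.ceil_lt_add_one (a := 4 * ℓ / ε) (by positivity)).le
    have h2 := mul_le_mul_of_nonneg_right h1 hε.le
    rw [add_mul, div_mul_cancel₀ _ hε.ne'] at h2
    push_cast
    linarith

theorem HolderDominated.measure_le {Ω Y : Type*} [MeasurableSpace Ω] [MeasurableSpace Y]
    {μ : Measure Ω} {f f' : Ω → Y} (hf : Measurable f) (hf' : Measurable f') {B : ENNReal} {s : ℝ}
    (hs : 0 < s) (h : HolderDominated μ f f' B s) {S : Set Y} (hS : MeasurableSet S) :
    μ {ω | f ω ∈ S} ≤ B * μ {ω | f' ω ∈ S} ^ (1 / s) := by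
  have h1 := h (S.indicator 1) (measurable_one.indicator hS)
  have e : ∀ y, S.indicator (1 : Y → ENNReal) y ^ s = S.indicator 1 y := fun y => by
    by_cases hy : y ∈ S <;> simp [hy, hs]
  simp only [e] at h1
  have h2 : ∀ k : Ω → Y, Measurable k →
      ∫⁻ ω, S.indicator (1 : Y → ENNReal) (k ω) ∂μ = μ {ω | k ω ∈ S} := fun k hk =>
    lintegral_indicator_one (μ := μ) (hk hS)
  rwa [h2 f hf, h2 f' hf'] at h1

theorem one_div_mul_self_ge {m : ℕ} {s : ℝ} (hs : s.HolderConjugate m) :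
    1 - 2 / (m : ℝ) ≤ 1 / (s * s) := by
  have h1 : s⁻¹ = 1 - (m : ℝ)⁻¹ := by have := hs.inv_add_inv_eq_one; linarith
  rw [one_div, mul_inv, h1, div_eq_mul_inv]
  nlinarith [sq_nonneg (m : ℝ)⁻¹]

theorem mainTheorem2 (K : ℝ) (hK : 0 < K) :
    ∃ c₁ : ℝ, 0 < c₁ ∧ ∃ c : ℝ, 0 < c ∧
      ∀ (𝒳 : Type*) (N r T τ : ℕ), τ ≤ N →
      ∀ (μ₀ : Measure (EuclideanSpace ℝ (Fin r))) [IsProbabilityMeasure μ₀]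
        (p : EuclideanSpace ℝ (Fin r) → ℝ) (lik : 𝒳 → EuclideanSpace ℝ (Fin r) → ℝ)
        (L : ℝ), 0 < L →
      ∀ ε δ : ℝ, 0 < ε → 0 < δ → δ < 1 → ε ≤ K * Real.log (1 / δ) →
        ε < c₁ * ((τ : ℝ) / (N : ℝ)) ^ 2 * (T : ℝ) →
      ∀ η : ℝ, 0 < η →
        η < ε ^ 2 * (N : ℝ) / (c ^ 2 * L ^ 2 * (T : ℝ) * Real.log (1 / δ)) →
        DifferentiallyPrivate (sgldLaw μ₀ τ fun _ => η)
          (sgld (N := N) (T := T) p lik L τ fun _ => η) ε δ := by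
  refine ⟨1, one_pos, 126 * (4 + 5 * K), by positivity, ?_⟩
  intro 𝒳 N r T τ hτ μ₀ _ p lik L hL ε δ hε hδ hδ1 hεK hεT η hη hηlt X X' hXX' S hS
  set ℓ := Real.log (1 / δ) with hℓ
  have hℓ0 : 0 < ℓ := Real.log_pos (by rw [one_div]; exact (one_lt_inv₀ hδ).2 hδ1)
  have hτN : 0 < τ ∧ 0 < T := by
    constructor <;> refine Nat.pos_of_ne_zero fun h0 => ?_ <;> simp [h0] at hεT <;> linarith
  have hτR : (0 : ℝ) < τ := by exact_mod_cast hτN.1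
  have hTR : (0 : ℝ) < T := by exact_mod_cast hτN.2
  have hNR : (0 : ℝ) < N := by exact_mod_cast hτN.1.trans_le hτ
  obtain ⟨m, hm4, hmδ, hmε⟩ := exists_order hε hεK hℓ0
  have hm4R : (4 : ℝ) ≤ m := by exact_mod_cast hm4
  set H := 4 + 5 * K with hH
  have hH4 : 4 < H := by linarith
  have hεN : ε * N ^ 2 < τ ^ 2 * T := by
    rw [one_mul, div_pow, div_mul_eq_mul_div, lt_div_iff₀ (by positivity)] at hεT
    exact hεT
  -- The bound on `η` keeps the total cost `63 m L² η T / N` of all iterations below `ε / 2`.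
  have hbudget : 126 * (m * (L ^ 2 * η * T)) ≤ ε * N := by
    rw [lt_div_iff₀ (by positivity)] at hηlt
    have h1 : m * ε * (L ^ 2 * η * T) ≤ H * ℓ * (L ^ 2 * η * T) := by gcongr
    have h2 : 126 * H * (126 * (H * ℓ * (L ^ 2 * η * T))) ≤ 126 * H * (ε * (ε * N)) / 1 := by
      have : 126 * H * (126 * (H * ℓ * (L ^ 2 * η * T)))
        = η * ((126 * H) ^ 2 * L ^ 2 * T * ℓ) := by ring
      rw [this]
      have h3 : ε ^ 2 * N ≤ 126 * H * (ε * (ε * N)) := by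
        have : 0 < ε * (ε * N) := by positivity
        nlinarith
      linarith
    have h4 : ε * (126 * (m * (L ^ 2 * η * T))) ≤ ε * (ε * N) := by
      have := le_of_mul_le_mul_left (h2.trans_eq (div_one _)) (by positivity)
      linarith
    exact le_of_mul_le_mul_left h4 hε
  -- Here `ε < q² T` turns the bound on the total cost into one on a single iteration.
  have hmσ : m * (L ^ 2 * η * N / (2 * τ ^ 2)) ≤ 1 := by
    rw [← mul_div_assoc, div_le_one (by positivity)]
    have h1 : m * (L ^ 2 * η * N) * T ≤ 2 * τ ^ 2 * T := by
      have h2 := mul_le_mul_of_nonneg_right hbudget hNR.le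
      have h3 : 0 < m * (L ^ 2 * η * N) * T := by positivity
      nlinarith
    exact le_of_mul_le_mul_right h1 hTR
  obtain ⟨s, hs⟩ : ∃ s : ℝ, s.HolderConjugate m :=
    ⟨_, (Real.HolderConjugate.conjExponent (by linarith)).symm⟩
  have hs1 : 1 ≤ s * s := by nlinarith [hs.lt]
  have hq0 : 0 ≤ (τ : ℝ) / N := by positivity
  have hq1 : (τ : ℝ) / N ≤ 1 := (div_le_one hNR).2 (by exact_mod_cast hτ)
  have hcoin := isProbabilityMeasure_coinLaw hq0 hq1
  have hbatch : IsProbabilityMeasure (minibatchLaw N ((τ : ℝ) / N)) := by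
    unfold minibatchLaw; infer_instance
  have hlaw : IsProbabilityMeasure (sgldLaw (N := N) (T := T) μ₀ τ fun _ => η) := by
    unfold sgldLaw; infer_instance
  have hF := fun X : Fin N → 𝒳 => measurable_sgldStep p lik L τ X η
  have hit := fun X : Fin N → 𝒳 => measurable_trajectory (T := T) (hF X)
  have htail : MeasurableSet {θs : Fin (T + 1) → EuclideanSpace ℝ (Fin r) |
      (fun t : Fin T => θs t.succ) ∈ S} :=
    (measurable_pi_lambda _ fun t => measurable_pi_apply _ : Measurable
      fun (θs : Fin (T + 1) → EuclideanSpace ℝ (Fin r)) (t : Fin T) => θs t.succ) hS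
  have hdom := (HolderDominated.prod (μ := μ₀) (hit X) (hit X') hs1
    (HolderDominated.pi_trajectory (hF X) (hF X') hs1
      (holderDominated_sgldStep hτ hτN.1 p lik hL hXX' hη hs hmσ) T)).measure_le
        (hit X) (hit X') (by linarith) htail
  set P := sgldLaw (N := N) (T := T) μ₀ τ fun _ => η with hP
  change P {ω | sgld p lik L τ (fun _ => η) X ω ∈ S}
    ≤ _ * P {ω | sgld p lik L τ (fun _ => η) X' ω ∈ S} ^ _ at hdom
  refine hdom.trans ?_
  set x := (P {ω | sgld p lik L τ (fun _ => η) X' ω ∈ S}).toReal with hx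
  have hPx : P {ω | sgld p lik L τ (fun _ => η) X' ω ∈ S} = ENNReal.ofReal x :=
    (ENNReal.ofReal_toReal (measure_ne_top _ _)).symm
  have hx0 : 0 ≤ x := ENNReal.toReal_nonneg
  have hx1 : x ≤ 1 := ENNReal.toReal_le_of_le_ofReal one_pos.le (by simpa using prob_le_one)
  rw [hPx, ← ENNReal.ofReal_mul (Real.exp_pos _).le, ← ENNReal.ofReal_add (by positivity) hδ.le,
    ENNReal.ofReal_rpow_of_nonneg hx0 (by positivity), ← ENNReal.ofReal_pow (Real.exp_pos _).le,
    ← ENNReal.ofReal_mul (by positivity)]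
  apply ENNReal.ofReal_le_ofReal
  have hβ1 : 2 / (m : ℝ) < 1 := by rw [div_lt_one (by linarith)]; linarith
  have hxs : x ^ (1 / (s * s)) ≤ x ^ (1 - 2 / (m : ℝ)) :=
    Real.rpow_le_rpow_of_exponent_ge_of_imp hx0 hx1 (one_div_mul_self_ge hs)
      (fun _ h => absurd h (one_div_pos.2 (by linarith)).ne')
  have hC : Real.exp (63 * (m * (L ^ 2 * η / N))) ^ T ≤ Real.exp (ε / 2) := by
    rw [← Real.exp_nat_mul]
    apply Real.exp_le_exp.2
    have : (T : ℝ) * (63 * (m * (L ^ 2 * η / N))) = 126 * (m * (L ^ 2 * η * T)) / N / 2 := by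
      ring
    rw [this]
    have := (div_le_iff₀ hNR).2 hbudget
    linarith
  refine (mul_le_mul_of_nonneg_left hxs (by positivity)).trans
    (mul_rpow_le_exp_mul_add hx0 (by positivity) hβ1 hC hδ ?_)
  have he : ε - ε / (2 * (2 / (m : ℝ))) ≤ Real.log δ := by
    have h1 : ε / (2 * (2 / (m : ℝ))) = ε * m / 4 := by
      field_simp
      ring
    have h2 : Real.log δ = -ℓ := by rw [hℓ, one_div, Real.log_inv, neg_neg]
    rw [h1, h2]
    exact hmδ
  exact (Real.exp_le_exp.2 he).trans_eq (Real.exp_log hδ)
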